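/- Let $\mathcal X$ be the space of all real-valued infinitely differentiable functions on $\mathbb R^d$ with bounded support. Say that $\phi_k\to\phi$ in $\mathcal X$ if the functions $\phi_k-\phi$ all vanish outside one common ball and their derivatives of every order (including order $0$) converge to $0$ uniformly. Continuity of functionals on $\mathcal X$ is understood with respect to this convergence of sequences; a generalized function is a continuous linear functional $\mathcal X\to\mathbb R$. A generalized random field $\Phi$ on $\mathcal X$ assigns to every $\phi\in\mathcal X$ a real random variable $\Phi(\phi)$ on one probability space, such that (i) for all $\phi,\psi\in\mathcal X$ and $\alpha,\beta\in\mathbb R$, $\Phi(\alpha\phi+\beta\psi)=\alpha\Phi(\phi)+\beta\Phi(\psi)$ almost surely, and (ii) whenever $\phi_{kj}\to\phi_j$ in $\mathcal X$ as $k\to\infty$ for $1\le j\le m$, the law of $(\Phi(\phi_{k1}),\dots,\Phi(\phi_{km}))$ converges weakly to the law of $(\Phi(\phi_1),\dots,\Phi(\phi_m))$. Its characteristic functional is $f(\phi)=E[e^{i\Phi(\phi)}]$. The field is called Gaussian if every $\Phi(\phi)$ is square integrable, its mean $m(\phi)=E[\Phi(\phi)]$ is a generalized function, and $$f(\phi)=\exp\Big(i\,m(\phi)-\tfrac12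 B(\phi,\phi)\Big),\qquad \phi\in\mathcal X,$$ where $B(\phi,\psi)=\operatorname{Cov}(\Phi(\phi),\Phi(\psi))$; the degenerate case $B(\phi,\phi)\equiv0$ is included. For $P:\mathcal X\to\mathbb C$ and $h\in\mathcal X$ put $(\Delta_hP)(\phi)=P(\phi+h)-P(\phi)$. The functional $P$ is a polynomial if there is an integer $n\ge0$ with $(\Delta_h^{n+1}P)(\phi)=0$ for all $\phi,h\in\mathcal X$; the least such $n$ is its degree. Theorem. Let $f$ be the characteristic functional of a generalized random field $\Phi$ on $\mathcal X$, and suppose that $f(y)=\exp(P(y))$ for all $y\in\mathcal X$, where $P:\mathcal X\to\mathbb C$ is a continuous polynomial. Then $P$ has degree at most $2$, and $\Phi$ is a Gaussian, possibly degenerate, generalized random field. -/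

import Mathlib

open MeasureTheory ProbabilityTheory Filter Topology
open scoped Distributions

noncomputable section

/-- The space of all real-valued smooth functions of `d` real variables with bounded support. -/
abbrev TestSpace (d : ℕ) : Type := 𝓓((⊤ : TopologicalSpace.Opens (EuclideanSpace ℝ (Fin d))), ℝ)

/-- A sequence of test functions converges to zero: all its members vanish outside one ball, and
the derivatives of every order tend to zero uniformly. -/
def ConvergesToZero {d : ℕ} (u : ℕ → TestSpace d) : Prop :=
  (∃ a : ℝ, ∀ k x, a ≤ ‖x‖ → u k x = 0) ∧
    ∀ q : ℕ, TendstoUniformly (fun k x => iteratedFDeriv ℝ q (u k) x) (fun _ => 0) atTop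

/-- Convergence of a sequence of test functions to a test function. -/
def ConvergesTo {d : ℕ} (u : ℕ → TestSpace d) (φ : TestSpace d) : Prop :=
  ConvergesToZero fun k => u k - φ

/-- Continuity of a (not necessarily linear) functional on the test space, with respect to the
convergence of sequences of test functions. -/
def IsContinuousFunctional {d : ℕ} (P : TestSpace d → ℂ) : Prop :=
  ∀ (u : ℕ → TestSpace d) (φ : TestSpace d), ConvergesTo u φ →
    Tendsto (fun k => P (u k)) atTop (𝓝 (P φ))

/-- A functional `P` is annihilated by the finite difference operators `Δ_h ^ (n + 1)`, where
`Δ_h P φ = P (φ + h) - P φ`. -/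
def IsPolynomialOfDegreeLE {d : ℕ} (P : TestSpace d → ℂ) (n : ℕ) : Prop :=
  ∀ φ h : TestSpace d, (fwdDiff h)^[n + 1] P φ = 0

/-- A functional on the test space is a polynomial. -/
def IsPolynomialFunctional {d : ℕ} (P : TestSpace d → ℂ) : Prop :=
  ∃ n : ℕ, IsPolynomialOfDegreeLE P n

/-- The degree of a polynomial functional: the least `n` with `Δ_h ^ (n + 1) P = 0` for all `h`
(only meaningful if `P` is a polynomial functional). -/
def polynomialDegree {d : ℕ} (P : TestSpace d → ℂ) : ℕ :=
  sInf {n : ℕ | IsPolynomialOfDegreeLE P n}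

/-- A generalized random field on the test space: a random functional which is linear (almost
surely, for each single linear relation) and continuous (the joint laws of finitely many of its
values depend continuously, in the sense of weak convergence, on the test functions). -/
structure IsGeneralizedRandomField {d : ℕ} {Ω : Type*} [MeasurableSpace Ω] (μ : Measure Ω)
    (Φ : TestSpace d → Ω → ℝ) : Prop where
  measurable : ∀ φ, Measurable (Φ φ)
  linear : ∀ (φ ψ : TestSpace d) (α β : ℝ),
    ∀ᵐ ω ∂μ, Φ (α • φ + β • ψ) ω = α * Φ φ ω + β * Φ ψ ω
  continuous : ∀ (m : ℕ) (u : Fin m → ℕ → TestSpace d) (φ : Fin m → TestSpace d),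
    (∀ j, ConvergesTo (u j) (φ j)) → ∀ f : BoundedContinuousFunction (Fin m → ℝ) ℝ,
      Tendsto (fun k => ∫ x, f x ∂(μ.map fun ω j => Φ (u j k) ω)) atTop
        (𝓝 (∫ x, f x ∂(μ.map fun ω j => Φ (φ j) ω)))

/-- The characteristic functional `φ ↦ E[exp(i Φ(φ))]`. -/
def characteristicFunctional {d : ℕ} {Ω : Type*} [MeasurableSpace Ω] (μ : Measure Ω)
    (Φ : TestSpace d → Ω → ℝ) (φ : TestSpace d) : ℂ :=
  ∫ ω, Complex.exp (Complex.I * (Φ φ ω : ℂ)) ∂μ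

/-- A generalized random field is Gaussian: its values are square integrable, and its
characteristic functional is `exp(i m(φ) - B(φ, φ) / 2)`, where the mean `m` is a generalized
function and `B` is the covariance functional. The degenerate case `B = 0` is included. -/
def IsGaussianField {d : ℕ} {Ω : Type*} [MeasurableSpace Ω] (μ : Measure Ω)
    (Φ : TestSpace d → Ω → ℝ) : Prop :=
  IsGeneralizedRandomField μ Φ ∧ (∀ φ, MemLp (Φ φ) 2 μ) ∧
    ∃ m : 𝓓'((⊤ : TopologicalSpace.Opens (EuclideanSpace ℝ (Fin d))), ℝ),
      (∀ φ, ∫ ω, Φ φ ω ∂μ = m φ) ∧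
      ∀ φ, characteristicFunctional μ Φ φ =
        Complex.exp (Complex.I * (m φ : ℂ) - (1 / 2 : ℂ) * (cov[Φ φ, Φ φ; μ] : ℂ))

end

/-!
Fix a test function `φ`. By homogeneity of the field, `t ↦ exp (P (t • φ))` is the characteristic
function of the law of `Φ φ`, and by Fréchet's theorem
(`exists_polynomial_eq_of_fwdDiff_iter_eq_zero`) the continuous function `t ↦ P (t • φ)` is an
ordinary polynomial. Marcinkiewicz's theorem (`natDegree_le_two_of_charFun_eq_exp`) says that its
degree is at most two, so `Φ φ` is Gaussian and
`P φ = P 0 + i E[Φ φ] - Var[Φ φ] / 2` (`exists_map_eq_gaussianReal`). The mean is linear in `φ` and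
the variance is quadratic in `φ`, whence `P` has degree at most two as a functional
(`isPolynomialOfDegreeLE_two`). The mean is the imaginary part of `P` up to a constant, so it is
sequentially continuous, and a sequentially continuous linear functional is a distribution
(`exists_distribution_of_sequentially_continuous`).

Marcinkiewicz's theorem is proved through the ridge property. If a characteristic function extends
to an entire function `F`, then the even moments are finite and given, up to sign, by the
derivatives of `F` at `0` (`integrable_pow_of_charFun_eq`, `integral_pow_eq_norm_iteratedDeriv`), so
all exponential moments are finite (`integrable_cosh_of_charFun_eq`), `F z = E[exp (i z X)]` for
complex `z`, and `‖F z‖ ≤ ‖F (i Im z)‖` (`norm_le_norm_mul_I_of_charFun_eq`). For `F = exp ∘ p` this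
reads `Re p (z) ≤ Re p (i Im z)`, which fails for large `z` in a suitable direction if
`deg p ≥ 3` (`natDegree_le_two_of_re_eval_le`).
-/

/-! ### Moments of a law whose characteristic function is entire -/

theorem iteratedDeriv_comp_ofReal {F : ℂ → ℂ} (hF : Differentiable ℂ F) (n : ℕ) :
    iteratedDeriv n (fun t : ℝ => F t) = fun t : ℝ => iteratedDeriv n F t := by
  induction n with
  | zero => simp
  | succ n ih =>
    rw [iteratedDeriv_succ, ih, iteratedDeriv_succ]
    funext t
    have hd : DifferentiableAt ℂ (iteratedDeriv n F) (t : ℂ) :=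
      (hF.contDiff (n := ⊤)).differentiable_iteratedDeriv n
        (by exact_mod_cast WithTop.coe_lt_top _) _
    exact hd.hasDerivAt.comp_ofReal.deriv

/-- The second symmetric difference of an entire function is `O(h ^ 2)`: it is an even function of
`h` that vanishes at `0`, so it is divisible by `h ^ 2`. -/
theorem exists_norm_symmetric_difference_le {H : ℂ → ℂ} (hH : Differentiable ℂ H) :
    ∃ C : ℝ, ∀ h : ℝ, 0 ≤ h → h ≤ 1 →
      ‖2 * H 0 - H h - H (-h)‖ ≤ C * h ^ 2 := by
  set φ : ℂ → ℂ := fun z => 2 * H 0 - H z - H (-z) with hφ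
  have hφd : Differentiable ℂ φ := by
    have h1 : Differentiable ℂ fun z => H (-z) := hH.comp differentiable_neg
    exact ((differentiable_const _).sub hH).sub h1
  have h0 : φ 0 = 0 := by simp [hφ]; ring
  have h1 : deriv φ 0 = 0 := by
    have e : (fun z => φ (-z)) = φ := by funext z; simp [hφ]; ring
    have := deriv_comp_neg φ 0
    rw [e] at this
    simp only [neg_zero] at this
    linear_combination (1 / 2 : ℂ) * this
  have hd1 : Differentiable ℂ (dslope φ 0) := by
    rw [← differentiableOn_univ] at hφd ⊢
    exact (Complex.differentiableOn_dslope univ_mem).2 hφd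
  have hd2 : Differentiable ℂ (dslope (dslope φ 0) 0) := by
    rw [← differentiableOn_univ] at hd1 ⊢
    exact (Complex.differentiableOn_dslope univ_mem).2 hd1
  have key : ∀ z, φ z = z ^ 2 * dslope (dslope φ 0) 0 z := by
    intro z
    have a := sub_smul_dslope φ 0 z
    have b := sub_smul_dslope (dslope φ 0) 0 z
    rw [dslope_same, h1] at b
    rw [h0] at a
    simp only [sub_zero, smul_eq_mul] at a b
    rw [pow_two, mul_assoc, b, a]
  obtain ⟨C, hC⟩ := (isCompact_Icc (a := (0 : ℝ)) (b := 1)).exists_bound_of_continuousOn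
    (f := fun h : ℝ => dslope (dslope φ 0) 0 (h : ℂ))
    ((hd2.continuous.comp Complex.continuous_ofReal).continuousOn)
  refine ⟨C, fun h hh0 hh1 => ?_⟩
  have := key h
  simp only [hφ] at this
  rw [this, norm_mul, norm_pow, Complex.norm_real, Real.norm_of_nonneg hh0, mul_comm]
  exact mul_le_mul_of_nonneg_right (hC h ⟨hh0, hh1⟩) (by positivity)

/-- A form of Fatou's lemma: as `h → 0` the weights `sinc (h x / 2) ^ 2` tend to `1`, so a uniform
bound on the weighted integrals of a nonnegative `g` makes `g` integrable. -/
theorem integrable_of_integral_sinc_le {μ : Measure ℝ} {g : ℝ → ℝ}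
    (hg : Measurable g) (hg0 : ∀ x, 0 ≤ g x) {C : ℝ}
    (hint : ∀ h : ℝ, 0 < h → h ≤ 1 → Integrable (fun x => g x * Real.sinc (h * x / 2) ^ 2) μ)
    (hC : ∀ h : ℝ, 0 < h → h ≤ 1 → ∫ x, g x * Real.sinc (h * x / 2) ^ 2 ∂μ ≤ C) :
    Integrable g μ := by
  set s : ℕ → ℝ := fun m => 1 / ((m : ℝ) + 1) with hs
  have hs0 : ∀ m, 0 < s m := fun m => by positivity
  have hs1 : ∀ m, s m ≤ 1 := fun m => by
    simp only [hs]; rw [div_le_one (by positivity)]; linarith [m.cast_nonneg (α := ℝ)]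
  have hst : Tendsto s atTop (𝓝 0) := tendsto_one_div_add_atTop_nhds_zero_nat
  set G : ℕ → ℝ → ENNReal := fun m x => ENNReal.ofReal (g x * Real.sinc (s m * x / 2) ^ 2) with hG
  have hGm : ∀ m, Measurable (G m) := fun m => by
    have := Real.continuous_sinc.measurable
    exact (hg.mul ((this.comp (by fun_prop)).pow_const 2)).ennreal_ofReal
  have hlim : ∀ x, liminf (fun m => G m x) atTop = ENNReal.ofReal (g x) := by
    intro x
    apply Tendsto.liminf_eq
    apply ENNReal.tendsto_ofReal
    have h1 : Tendsto (fun m => s m * x / 2) atTop (𝓝 0) := by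
      simpa using (hst.mul_const x).div_const 2
    have h2 := (Real.continuous_sinc.tendsto 0).comp h1
    simpa using (h2.pow 2).const_mul (g x)
  have hle : ∫⁻ x, ENNReal.ofReal (g x) ∂μ ≤ ENNReal.ofReal C := by
    calc ∫⁻ x, ENNReal.ofReal (g x) ∂μ = ∫⁻ x, liminf (fun m => G m x) atTop ∂μ := by
          simp_rw [hlim]
      _ ≤ liminf (fun m => ∫⁻ x, G m x ∂μ) atTop := lintegral_liminf_le hGm
      _ ≤ ENNReal.ofReal C := by
          apply liminf_le_of_frequently_le'
          refine Frequently.of_forall fun m => ?_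
          rw [← ofReal_integral_eq_lintegral_ofReal (hint _ (hs0 m) (hs1 m))
            (ae_of_all _ fun x => mul_nonneg (hg0 x) (sq_nonneg _))]
          exact ENNReal.ofReal_le_ofReal (hC _ (hs0 m) (hs1 m))
  refine ⟨hg.aestronglyMeasurable, ?_⟩
  rw [hasFiniteIntegral_iff_ofReal (ae_of_all _ hg0)]
  exact hle.trans_lt ENNReal.ofReal_lt_top

theorem memLp_id_of_integrable_pow {μ : Measure ℝ} {k : ℕ}
    (h : Integrable (fun x : ℝ => x ^ (2 * k)) μ) : MemLp id ((2 * k : ℕ) : ENNReal) μ := by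
  rcases Nat.eq_zero_or_pos k with rfl | hk
  · simpa using measurable_id.aestronglyMeasurable
  · rw [← integrable_norm_rpow_iff measurable_id.aestronglyMeasurable
      (by exact_mod_cast (by omega : 2 * k ≠ 0)) (ENNReal.natCast_ne_top _)]
    simpa [pow_mul, Real.rpow_natCast, Real.rpow_mul] using h

/-- The second symmetric difference of `t ↦ exp (i t x)` is `h ^ 2` times an approximation of
`x ^ 2`, written with `sinc` so that the formula also holds at `h x = 0`. -/
theorem two_sub_exp_sub_exp_eq (h x : ℝ) :
    2 - Complex.exp (h * x * Complex.I) - Complex.exp (-h * x * Complex.I)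
      = ((h ^ 2 * (x ^ 2 * Real.sinc (h * x / 2) ^ 2) : ℝ) : ℂ) := by
  have e : h ^ 2 * (x ^ 2 * Real.sinc (h * x / 2) ^ 2) = 2 - 2 * Real.cos (h * x) := by
    by_cases hx : h * x / 2 = 0
    · have h0 : h * x = 0 := by linarith
      have : h ^ 2 * (x ^ 2 * Real.sinc (h * x / 2) ^ 2)
          = (h * x) ^ 2 * Real.sinc (h * x / 2) ^ 2 := by ring
      rw [this, h0]; simp
    · rw [Real.sinc_of_ne_zero hx]
      have : Real.cos (h * x) = 1 - 2 * Real.sin (h * x / 2) ^ 2 := by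
        have := Real.cos_two_mul (h * x / 2)
        rw [mul_div_cancel₀ _ two_ne_zero] at this
        rw [this, Real.cos_sq']; ring
      rw [this]
      have hh : h ≠ 0 := by rintro rfl; simp at hx
      have hxx : x ≠ 0 := by rintro rfl; simp at hx
      field_simp
      ring
  rw [e]
  push_cast
  rw [Complex.cos]
  ring_nf

/-- If the characteristic function is the restriction of an entire function, all even moments are
finite. The second symmetric difference at `0` of the `2k`-th derivative bounds the integrals of
`x ^ (2k + 2) sinc (h x / 2) ^ 2`, and these control the next even moment. -/
theorem integrable_pow_of_charFun_eq {μ : Measure ℝ} [IsProbabilityMeasure μ] {F : ℂ → ℂ}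
    (hF : Differentiable ℂ F) (hμ : ∀ t : ℝ, charFun μ t = F t) (k : ℕ) :
    Integrable (fun x : ℝ => x ^ (2 * k)) μ := by
  induction k with
  | zero => simp
  | succ k ih =>
    have hLp := memLp_id_of_integrable_pow ih
    have hHd : Differentiable ℂ (iteratedDeriv (2 * k) F) :=
      (hF.contDiff (n := ⊤)).differentiable_iteratedDeriv _ (by exact_mod_cast WithTop.coe_lt_top _)
    obtain ⟨C, hC⟩ := exists_norm_symmetric_difference_le hHd
    set E : ℝ → ℂ := fun t =>
      ∫ x : ℝ, (x : ℂ) ^ (2 * k) * Complex.exp (t * x * Complex.I) ∂μ with hE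
    have hEi : ∀ t : ℝ,
        Integrable (fun x : ℝ => (x : ℂ) ^ (2 * k) * Complex.exp (t * x * Complex.I)) μ := by
      intro t
      have h1 : Integrable (fun x : ℝ => (x : ℂ) ^ (2 * k)) μ := by
        simpa using ih.ofReal (𝕜 := ℂ)
      refine h1.mul_bdd (c := 1) (by fun_prop) (ae_of_all _ fun x => ?_)
      rw [← Complex.ofReal_mul, Complex.norm_exp_ofReal_mul_I]
    have hHE : ∀ t : ℝ, iteratedDeriv (2 * k) F t = Complex.I ^ (2 * k) * E t := by
      intro t
      rw [← iteratedDeriv_charFun hLp, show charFun μ = fun t : ℝ => F t from funext hμ,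
        iteratedDeriv_comp_ofReal hF]
    have hsum : ∀ h : ℝ, Integrable (fun x : ℝ =>
          ((h ^ 2 * (x ^ (2 * (k + 1)) * Real.sinc (h * x / 2) ^ 2) : ℝ) : ℂ)) μ ∧
        2 * E 0 - E h - E (-h)
          = ∫ x : ℝ, ((h ^ 2 * (x ^ (2 * (k + 1)) * Real.sinc (h * x / 2) ^ 2) : ℝ) : ℂ) ∂μ := by
      intro h
      have e : (fun x : ℝ =>
          ((h ^ 2 * (x ^ (2 * (k + 1)) * Real.sinc (h * x / 2) ^ 2) : ℝ) : ℂ))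
          = fun x : ℝ => 2 * ((x : ℂ) ^ (2 * k) * Complex.exp ((0 : ℝ) * x * Complex.I))
            - (x : ℂ) ^ (2 * k) * Complex.exp (h * x * Complex.I)
            - (x : ℂ) ^ (2 * k) * Complex.exp ((-h : ℝ) * x * Complex.I) := by
        funext x
        have := two_sub_exp_sub_exp_eq h x
        have e2 : ((h ^ 2 * (x ^ (2 * (k + 1)) * Real.sinc (h * x / 2) ^ 2) : ℝ) : ℂ)
            = (x : ℂ) ^ (2 * k) * ((h ^ 2 * (x ^ 2 * Real.sinc (h * x / 2) ^ 2) : ℝ) : ℂ) := by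
          push_cast; ring
        rw [e2, ← this]
        push_cast
        simp
        ring
      rw [e]
      have i0 := (hEi 0).const_mul 2
      have i1 : Integrable (fun x : ℝ =>
            2 * ((x : ℂ) ^ (2 * k) * Complex.exp ((0 : ℝ) * x * Complex.I))
            - (x : ℂ) ^ (2 * k) * Complex.exp (h * x * Complex.I)) μ := i0.sub (hEi h)
      refine ⟨i1.sub (hEi (-h)), ?_⟩
      rw [integral_sub i1 (hEi (-h)), integral_sub i0 (hEi h), integral_const_mul]
    have hint : ∀ h : ℝ, 0 < h →
        Integrable (fun x : ℝ => x ^ (2 * (k + 1)) * Real.sinc (h * x / 2) ^ 2) μ := by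
      intro h hh
      have h1 := (hsum h).1.re
      simp only [RCLike.re_to_complex,
        Complex.ofReal_re] at h1
      have h2 := h1.const_mul (h ^ 2)⁻¹
      refine h2.congr (ae_of_all _ fun x => ?_)
      have : h ^ 2 ≠ 0 := by positivity
      simp only
      field_simp
    refine integrable_of_integral_sinc_le (C := C) (by fun_prop) (fun x => ?_)
      (fun h hh _ => hint h hh) (fun h hh hh1 => ?_)
    · rw [pow_mul]; positivity
    · have h1 := hC h hh.le hh1
      have h2 := (hsum h).2
      rw [integral_complex_ofReal, integral_const_mul] at h2
      have e : 2 * iteratedDeriv (2 * k) F 0 - iteratedDeriv (2 * k) F h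
          - iteratedDeriv (2 * k) F (-h) = Complex.I ^ (2 * k) * (2 * E 0 - E h - E (-h)) := by
        have a := hHE 0
        have b := hHE h
        have c := hHE (-h)
        push_cast at a b c
        rw [a, b, c]; ring
      rw [e, norm_mul, norm_pow, Complex.norm_I, one_pow, one_mul, h2, Complex.norm_real] at h1
      have h3 := (le_abs_self _).trans h1
      rw [mul_comm C] at h3
      exact le_of_mul_le_mul_left h3 (by positivity)

theorem integral_pow_eq_norm_iteratedDeriv {μ : Measure ℝ} [IsProbabilityMeasure μ] {F : ℂ → ℂ}
    (hF : Differentiable ℂ F) (hμ : ∀ t : ℝ, charFun μ t = F t) (k : ℕ) :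
    ∫ x, x ^ (2 * k) ∂μ = ‖iteratedDeriv (2 * k) F 0‖ := by
  have hLp := memLp_id_of_integrable_pow (integrable_pow_of_charFun_eq hF hμ k)
  have h := iteratedDeriv_charFun_zero hLp
  rw [show charFun μ = fun t : ℝ => F t from funext hμ, iteratedDeriv_comp_ofReal hF] at h
  simp only [Complex.ofReal_zero] at h
  rw [h, norm_mul, norm_pow, Complex.norm_I, one_pow, one_mul]
  have e : ∫ x : ℝ, (x : ℂ) ^ (2 * k) ∂μ = ((∫ x, x ^ (2 * k) ∂μ : ℝ) : ℂ) := by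
    rw [← integral_complex_ofReal]; simp
  rw [Complex.norm_real, Real.norm_of_nonneg]
  exact integral_nonneg fun x => by rw [pow_mul]; positivity

/-! ### Exponential moments and the ridge property -/

/-- The series `∑ r ^ (2k) / (2k)! * E[X ^ (2k)]` is, up to signs, the even part of the Taylor
series of the entire function `F`, so it converges for every `r`. -/
theorem integrable_cosh_of_charFun_eq {μ : Measure ℝ} [IsProbabilityMeasure μ] {F : ℂ → ℂ}
    (hF : Differentiable ℂ F) (hμ : ∀ t : ℝ, charFun μ t = F t) (r : ℝ) :
    Integrable (fun x => Real.cosh (r * x)) μ := by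
  have hs : Summable fun k : ℕ => r ^ (2 * k) / (2 * k).factorial * ∫ x, x ^ (2 * k) ∂μ := by
    have h1 := (Complex.hasSum_taylorSeries_of_entire hF 0 (r : ℂ)).summable.norm
    have h2 := h1.comp_injective (i := fun k : ℕ => 2 * k)
      (fun a b h => by simpa using h)
    refine h2.congr fun k => ?_
    rw [integral_pow_eq_norm_iteratedDeriv hF hμ]
    simp only [Function.comp, norm_smul, norm_inv, sub_zero, Complex.norm_natCast, norm_pow,
      Complex.norm_real, Real.norm_eq_abs, pow_mul, sq_abs]
    ring
  refine ⟨by fun_prop, ?_⟩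
  rw [hasFiniteIntegral_iff_ofReal (ae_of_all _ fun x => (Real.cosh_pos _).le)]
  have e : ∀ x, ENNReal.ofReal (Real.cosh (r * x))
      = ∑' k : ℕ, ENNReal.ofReal (r ^ (2 * k) / (2 * k).factorial * x ^ (2 * k)) := by
    intro x
    have h := Real.hasSum_cosh (r * x)
    rw [← h.tsum_eq,
      ENNReal.ofReal_tsum_of_nonneg (fun n => by rw [pow_mul]; positivity) h.summable]
    congr 1; funext k; rw [mul_pow]; congr 1; ring
  simp_rw [e]
  rw [lintegral_tsum fun k => by fun_prop]
  have e2 : ∀ k : ℕ, ∫⁻ x, ENNReal.ofReal (r ^ (2 * k) / (2 * k).factorial * x ^ (2 * k)) ∂μ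
      = ENNReal.ofReal (r ^ (2 * k) / (2 * k).factorial * ∫ x, x ^ (2 * k) ∂μ) := by
    intro k
    rw [← integral_const_mul, ofReal_integral_eq_lintegral_ofReal
      ((integrable_pow_of_charFun_eq hF hμ k).const_mul _)]
    exact ae_of_all _ fun x => by simp only [pow_mul, Pi.zero_apply]; positivity
  simp_rw [e2]
  exact hs.tsum_ofReal_lt_top

theorem integrable_exp_of_charFun_eq {μ : Measure ℝ} [IsProbabilityMeasure μ] {F : ℂ → ℂ}
    (hF : Differentiable ℂ F) (hμ : ∀ t : ℝ, charFun μ t = F t) (r : ℝ) :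
    Integrable (fun x => Real.exp (r * x)) μ := by
  refine ((integrable_cosh_of_charFun_eq hF hμ r).const_mul 2).mono' (by fun_prop)
    (ae_of_all _ fun x => ?_)
  rw [Real.norm_of_nonneg (Real.exp_pos _).le, Real.cosh_eq]
  have := Real.exp_pos (-(r * x))
  linarith

/-- The ridge property: `F z = E[exp (i z X)]` on all of `ℂ`, by the identity theorem, hence the
modulus of `F` on a horizontal line is largest on the imaginary axis. -/
theorem norm_le_norm_mul_I_of_charFun_eq {μ : Measure ℝ} [IsProbabilityMeasure μ] {F : ℂ → ℂ}
    (hF : Differentiable ℂ F) (hμ : ∀ t : ℝ, charFun μ t = F t) (z : ℂ) :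
    ‖F z‖ ≤ ‖F (z.im * Complex.I)‖ := by
  have hset : integrableExpSet id μ = Set.univ := by
    ext r
    simpa [integrableExpSet] using integrable_exp_of_charFun_eq hF hμ r
  have han : AnalyticOnNhd ℂ (complexMGF id μ) Set.univ := by
    have := analyticOnNhd_complexMGF (X := id) (μ := μ)
    rw [hset] at this
    simpa using this
  set G : ℂ → ℂ := fun z => complexMGF id μ (z * Complex.I) with hG
  have hGd : Differentiable ℂ G := by
    have : Differentiable ℂ (complexMGF id μ) := fun z => (han z trivial).differentiableAt
    exact this.comp (differentiable_id.mul_const _)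
  have hGF : G = F := by
    refine AnalyticOnNhd.eq_of_frequently_eq (z₀ := 0)
      (hGd.differentiableOn.analyticOnNhd isOpen_univ)
      (hF.differentiableOn.analyticOnNhd isOpen_univ) ?_
    have ht : Tendsto (fun t : ℝ => (t : ℂ)) (𝓝[≠] 0) (𝓝[≠] 0) := by
      refine tendsto_nhdsWithin_iff.2 ⟨?_, ?_⟩
      · exact (Complex.continuous_ofReal.tendsto' 0 0 (by simp)).mono_left nhdsWithin_le_nhds
      · filter_upwards [self_mem_nhdsWithin] with t ht
        simpa using ht
    refine ht.frequently (Frequently.of_forall fun t => ?_)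
    rw [← hμ t, ← complexMGF_id_mul_I]
  have h1 : ‖G z‖ ≤ mgf id μ (z * Complex.I).re := norm_complexMGF_le_mgf
  have h2 : G (z.im * Complex.I) = mgf id μ (-z.im) := by
    rw [← complexMGF_ofReal]
    simp only [hG]
    congr 1
    rw [mul_assoc, Complex.I_mul_I]; push_cast; ring
  rw [← hGF, h2, Complex.norm_real]
  refine h1.trans ?_
  rw [show (z * Complex.I).re = -z.im by simp]
  exact le_abs_self _

/-! ### Marcinkiewicz's theorem -/

open Polynomial in
/-- The leading behaviour of a polynomial along a ray, written with `t = 1 / R`; the direction `w`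
may be zero. -/
theorem tendsto_pow_mul_eval_div (p : ℂ[X]) (w : ℂ) :
    Tendsto (fun t : ℝ => (t : ℂ) ^ p.natDegree * p.eval (w / t)) (𝓝[>] 0)
      (𝓝 (p.leadingCoeff * w ^ p.natDegree)) := by
  set n := p.natDegree with hn
  have hq : Continuous fun t : ℝ =>
      ∑ i ∈ Finset.range (n + 1), p.coeff i * w ^ i * (t : ℂ) ^ (n - i) := by fun_prop
  have h0 := hq.tendsto 0
  have e0 : ∑ i ∈ Finset.range (n + 1), p.coeff i * w ^ i * ((0 : ℝ) : ℂ) ^ (n - i)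
      = p.leadingCoeff * w ^ n := by
    rw [Finset.sum_range_succ, Finset.sum_eq_zero]
    · simp [hn]
    · intro i hi
      have : n - i ≠ 0 := by have := Finset.mem_range.1 hi; omega
      simp [this]
  rw [e0] at h0
  refine (h0.mono_left nhdsWithin_le_nhds).congr' ?_
  filter_upwards [self_mem_nhdsWithin] with t ht
  have ht0 : (t : ℂ) ≠ 0 := by exact_mod_cast (ne_of_gt ht)
  rw [eval_eq_sum_range, Finset.mul_sum]
  refine Finset.sum_congr rfl fun i hi => ?_
  have hi' : i ≤ n := by have := Finset.mem_range.1 hi; omega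
  rw [div_pow, ← pow_sub_mul_pow (t : ℂ) hi']
  field_simp

theorem abs_im_lt_one {w : ℂ} (hw : ‖w‖ = 1) (hI : w ^ 2 ≠ -1) : |w.im| < 1 := by
  have h1 : w.re ^ 2 + w.im ^ 2 = 1 := by
    have := Complex.sq_norm w
    rw [hw, Complex.normSq_apply] at this
    linarith
  rw [← sq_lt_one_iff_abs_lt_one]
  by_contra h
  have hre : w.re = 0 := by nlinarith [sq_nonneg w.re]
  apply hI
  have him : w.im ^ 2 = 1 := by rw [hre] at h1; linarith
  apply Complex.ext
  · rw [pow_two, Complex.mul_re]; simp [hre]; linarith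
  · rw [pow_two, Complex.mul_im]; simp [hre]

/-- For `n ≥ 3`, one of the directions in which `a z ^ n` is real and positive is not `±i`: there
are `n` such directions on the unit circle. -/
theorem exists_mul_pow_eq_norm_and_abs_im_lt_one {n : ℕ} (hn : 3 ≤ n) {a : ℂ} (ha : a ≠ 0) :
    ∃ w : ℂ, a * w ^ n = ‖a‖ ∧ |w.im| < 1 := by
  obtain ⟨w, hw⟩ := IsAlgClosed.exists_pow_nat_eq ((‖a‖ : ℂ) / a) (by omega : 0 < n)
  have hna : (‖a‖ : ℝ) ≠ 0 := norm_ne_zero_iff.2 ha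
  have hnorm : ∀ u : ℂ, u ^ n = (‖a‖ : ℂ) / a → ‖u‖ = 1 := by
    intro u hu
    have : ‖u‖ ^ n = 1 := by
      rw [← norm_pow, hu, norm_div, Complex.norm_real, norm_norm, div_self hna]
    exact (pow_eq_one_iff_of_nonneg (norm_nonneg _) (by omega)).1 this
  have hmul : ∀ u : ℂ, u ^ n = (‖a‖ : ℂ) / a → a * u ^ n = ‖a‖ := by
    intro u hu; rw [hu]; field_simp
  by_cases hI : w ^ 2 = -1
  -- Multiplying `±i` by a primitive `n`-th root of unity gives another admissible direction, which
  -- could be `±i` again only if `n ∣ 2`.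
  · set ζ := Complex.exp (2 * Real.pi * Complex.I / n) with hζ
    have hprim : IsPrimitiveRoot ζ n := Complex.isPrimitiveRoot_exp n (by omega)
    have hu : (w * ζ) ^ n = (‖a‖ : ℂ) / a := by rw [mul_pow, hw, hprim.pow_eq_one, mul_one]
    refine ⟨w * ζ, hmul _ hu, abs_im_lt_one (hnorm _ hu) fun h => ?_⟩
    have : ζ ^ 2 = 1 := by
      rw [mul_pow, hI] at h; linear_combination -h
    have := Nat.le_of_dvd (by norm_num) (hprim.dvd_of_pow_eq_one 2 this)
    omega
  · exact ⟨w, hmul w hw, abs_im_lt_one (hnorm w hw) hI⟩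

/-- In degree `n ≥ 3`, comparing leading terms of `Re p (R w)` and `Re p (i R Im w)` along a
direction `w ≠ ±i` of fastest growth gives `|a| ≤ |a| |Im w| ^ n < |a|`. -/
theorem natDegree_le_two_of_re_eval_le {p : Polynomial ℂ}
    (hp : ∀ z : ℂ, (p.eval z).re ≤ (p.eval (z.im * Complex.I)).re) : p.natDegree ≤ 2 := by
  by_contra hn
  push Not at hn
  have hp0 : p ≠ 0 := by rintro rfl; simp at hn
  have ha : p.leadingCoeff ≠ 0 := Polynomial.leadingCoeff_ne_zero.2 hp0
  obtain ⟨w, hw, hw1⟩ := exists_mul_pow_eq_norm_and_abs_im_lt_one hn ha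
  have h1 := (Complex.continuous_re.tendsto _).comp (tendsto_pow_mul_eval_div p w)
  have h2 := (Complex.continuous_re.tendsto _).comp
    (tendsto_pow_mul_eval_div p (w.im * Complex.I))
  have hle := le_of_tendsto_of_tendsto h1 h2 (by
    filter_upwards [self_mem_nhdsWithin] with t ht
    have ht' : (0 : ℝ) < t := ht
    simp only [Function.comp_apply]
    rw [← Complex.ofReal_pow, Complex.re_ofReal_mul, Complex.re_ofReal_mul]
    refine mul_le_mul_of_nonneg_left ?_ (by positivity)
    have := hp (w / t)
    rwa [Complex.div_ofReal_im, Complex.ofReal_div, div_mul_eq_mul_div] at this)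
  rw [hw, Complex.ofReal_re] at hle
  have h3 := hle.trans (Complex.re_le_norm _)
  rw [norm_mul, norm_pow, norm_mul, Complex.norm_I, mul_one, Complex.norm_real,
    Real.norm_eq_abs] at h3
  have h4 : |w.im| ^ p.natDegree < 1 := pow_lt_one₀ (abs_nonneg _) hw1 (by omega)
  have h5 : 0 < ‖p.leadingCoeff‖ := norm_pos_iff.2 ha
  nlinarith

/-- Marcinkiewicz's theorem: if `exp ∘ p` is a characteristic function, the polynomial `p` has
degree at most two. -/
theorem natDegree_le_two_of_charFun_eq_exp {μ : Measure ℝ} [IsProbabilityMeasure μ]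
    {p : Polynomial ℂ} (hμ : ∀ t : ℝ, charFun μ t = Complex.exp (p.eval (t : ℂ))) :
    p.natDegree ≤ 2 := by
  apply natDegree_le_two_of_re_eval_le
  intro z
  have hF : Differentiable ℂ fun z => Complex.exp (p.eval z) := p.differentiable.cexp
  have := norm_le_norm_mul_I_of_charFun_eq hF hμ z
  rwa [Complex.norm_exp, Complex.norm_exp, Real.exp_le_exp] at this

theorem eq_zero_of_exp_mul_sq_eq_one {y : ℝ}
    (h : ∀ t : ℝ, Complex.exp (y * t ^ 2 * Complex.I) = 1) : y = 0 := by
  by_contra hy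
  have h1 := h (Real.sqrt (Real.pi / |y|))
  have h2 : (y * Real.sqrt (Real.pi / |y|) ^ 2 : ℝ) = Real.pi ∨
      (y * Real.sqrt (Real.pi / |y|) ^ 2 : ℝ) = -Real.pi := by
    rw [Real.sq_sqrt (by positivity)]
    rcases lt_or_gt_of_ne hy with h | h
    · right; rw [abs_of_neg h]; field_simp
    · left; rw [abs_of_pos h]; field_simp
  rw [← Complex.ofReal_pow, ← Complex.ofReal_mul] at h1
  rcases h2 with h2 | h2 <;> rw [h2] at h1
  · rw [Complex.exp_pi_mul_I] at h1; norm_num at h1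
  · rw [Complex.ofReal_neg, neg_mul, Complex.exp_neg, Complex.exp_pi_mul_I] at h1
    norm_num at h1

/-- A law with characteristic function `exp ∘ p` is Gaussian. The constant term of `p` is only
known to be a multiple of `2πi`, so it stays in the formula for `p`. -/
theorem exists_eq_gaussianReal_of_charFun_eq_exp {μ : Measure ℝ} [IsProbabilityMeasure μ]
    {p : Polynomial ℂ} (hμ : ∀ t : ℝ, charFun μ t = Complex.exp (p.eval (t : ℂ))) :
    ∃ (m : ℝ) (v : NNReal), μ = gaussianReal m v ∧
      ∀ t : ℝ, p.eval (t : ℂ) = p.eval 0 + t * m * Complex.I - v * t ^ 2 / 2 := by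
  have hdeg := natDegree_le_two_of_charFun_eq_exp hμ
  set a := p.coeff 0
  set b := p.coeff 1
  set c := p.coeff 2
  have hp : ∀ z : ℂ, p.eval z = a + b * z + c * z ^ 2 := by
    intro z
    rw [Polynomial.eval_eq_sum_range' (n := 3) (by omega)]
    simp [Finset.sum_range_succ, a, b, c]
  have ha : Complex.exp a = 1 := by
    have := hμ 0
    simpa [hp] using this.symm
  have hμ' : ∀ t : ℝ, charFun μ t = Complex.exp (b * t + c * t ^ 2) := by
    intro t
    rw [hμ, hp, add_assoc, Complex.exp_add, ha, one_mul]
  have hre : ∀ t : ℝ, b.re * t + c.re * t ^ 2 ≤ 0 := by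
    intro t
    have h := norm_charFun_le_one (μ := μ) t
    rw [hμ', Complex.norm_exp, Real.exp_le_one_iff, ← Complex.ofReal_pow, Complex.add_re,
      Complex.re_mul_ofReal, Complex.re_mul_ofReal] at h
    exact h
  have hc : c.re ≤ 0 := by
    have h1 := hre 1
    have h2 := hre (-1)
    linarith
  have hb : b.re = 0 := by
    by_contra hb
    rcases eq_or_lt_of_le hc with h0 | h0
    · have := hre b.re
      rw [h0] at this
      have : 0 < b.re ^ 2 := by positivity
      nlinarith
    -- the vertex of the parabola `Re b * t + Re c * t ^ 2`
    · have := hre (-b.re / (2 * c.re))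
      have e : b.re * (-b.re / (2 * c.re)) + c.re * (-b.re / (2 * c.re)) ^ 2
          = b.re ^ 2 / (4 * (-c.re)) := by
        have := h0.ne
        field_simp
        ring
      rw [e] at this
      have h3 : 0 < b.re ^ 2 / (4 * (-c.re)) := by
        apply div_pos <;> [positivity; linarith]
      linarith
  have hbI : b = b.im * Complex.I := by
    apply Complex.ext <;> simp [hb]
  -- `charFun μ (-t) = conj (charFun μ t)` forces `exp (2 i t ^ 2 Im c) = 1` for all `t`.
  have hcim : c.im = 0 := by
    have : 2 * c.im = 0 := by
      apply eq_zero_of_exp_mul_sq_eq_one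
      intro t
      have h := charFun_neg (μ := μ) t
      rw [hμ', hμ', ← Complex.exp_conj] at h
      have hcc : c - (starRingEnd ℂ) c = 2 * c.im * Complex.I := by
        apply Complex.ext <;> simp; ring
      have hbc : (starRingEnd ℂ) b = -b := by
        rw [hbI]; simp
      simp only [map_add, map_mul, map_pow, Complex.conj_ofReal, hbc] at h
      have e : ((2 * c.im : ℝ) : ℂ) * t ^ 2 * Complex.I
          = (b * (-t : ℝ) + c * (-t : ℝ) ^ 2) - (-b * t + (starRingEnd ℂ) c * t ^ 2) := by
        push_cast
        linear_combination -(t : ℂ) ^ 2 * hcc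
      rw [e, Complex.exp_sub, h, div_self (Complex.exp_ne_zero _)]
    linarith
  have hcr : c = (c.re : ℂ) := by
    apply Complex.ext <;> simp [hcim]
  obtain ⟨v, hv⟩ : ∃ v : NNReal, (v : ℝ) = -2 * c.re :=
    ⟨(-2 * c.re).toNNReal, Real.coe_toNNReal _ (by linarith)⟩
  have hv' : c = -(v : ℂ) / 2 := by
    have h : (v : ℂ) = -2 * (c.re : ℂ) := by exact_mod_cast congrArg Complex.ofReal hv
    rw [h]; linear_combination hcr
  refine ⟨b.im, v, ?_, fun t => ?_⟩
  · apply Measure.ext_of_charFun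
    funext t
    rw [hμ', charFun_gaussianReal]
    congr 1
    linear_combination (t : ℂ) * hbI + (t : ℂ) ^ 2 * hv'
  · rw [hp, hp]
    linear_combination (t : ℂ) * hbI + (t : ℂ) ^ 2 * hv'

/-! ### Fréchet's theorem on continuous functions with vanishing differences -/

theorem fwdDiff_iter_eq_zero_of_le {M G : Type*} [AddCommMonoid M] [AddCommGroup G] {h : M}
    {f : M → G} {n k : ℕ} (hf : ∀ y, (fwdDiff h)^[n] f y = 0) (hk : n ≤ k) (y : M) :
    (fwdDiff h)^[k] f y = 0 := by
  obtain ⟨j, rfl⟩ := Nat.exists_eq_add_of_le' hk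
  have h0 : (fwdDiff h)^[n] f = fun _ => 0 := funext hf
  rw [Function.iterate_add_apply, h0]
  clear hk
  induction j generalizing y with
  | zero => rfl
  | succ j ih =>
    rw [Function.iterate_succ_apply']
    simp [fwdDiff, ih]

/-- Along an arithmetic progression, a function with vanishing differences is a polynomial in the
index, by Newton's formula. -/
theorem exists_polynomial_eval_eq_add_nsmul {M : Type*} [AddCommMonoid M] {h : M}
    {g : M → ℂ} {n : ℕ} (hg : ∀ y, (fwdDiff h)^[n + 1] g y = 0) (s : M) :
    ∃ q : Polynomial ℂ, ∀ k : ℕ, g (s + k • h) = q.eval (k : ℂ) := by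
  refine ⟨∑ j ∈ Finset.range (n + 1),
    Polynomial.C ((fwdDiff h)^[j] g s / j.factorial) * descPochhammer ℂ j, fun k => ?_⟩
  rw [shift_eq_sum_fwdDiff_iter h g k s, Polynomial.eval_finsetSum]
  have e : ∀ j,
      (Polynomial.C ((fwdDiff h)^[j] g s / j.factorial) * descPochhammer ℂ j).eval (k : ℂ)
      = k.choose j • (fwdDiff h)^[j] g s := by
    intro j
    rw [Polynomial.eval_mul, Polynomial.eval_C, descPochhammer_eval_eq_descFactorial,
      Nat.descFactorial_eq_factorial_mul_choose, nsmul_eq_mul]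
    have : (j.factorial : ℂ) ≠ 0 := by exact_mod_cast j.factorial_ne_zero
    push_cast
    field_simp
  simp_rw [e]
  rcases le_total k n with hkn | hkn
  · refine Finset.sum_subset (Finset.range_mono (by omega)) fun j _ hj => ?_
    rw [Nat.choose_eq_zero_of_lt (by simpa using hj), zero_smul]
  · refine (Finset.sum_subset (Finset.range_mono (by omega)) fun j _ hj => ?_).symm
    rw [fwdDiff_iter_eq_zero_of_le hg (by simpa using hj), smul_zero]

/-- A continuous function on `ℝ` whose differences of some order vanish for every step is a
polynomial. Each rational number lies on a progression `-M + k / N`, `k ∈ ℕ`, that contains all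
natural numbers, so the polynomial attached to that progression is the one attached to `ℕ`. -/
theorem exists_polynomial_eq_of_fwdDiff_iter_eq_zero {g : ℝ → ℂ} (hgc : Continuous g) {n : ℕ}
    (hg : ∀ h y, (fwdDiff h)^[n + 1] g y = 0) :
    ∃ p : Polynomial ℂ, ∀ t : ℝ, g t = p.eval (t : ℂ) := by
  obtain ⟨p, hp⟩ := exists_polynomial_eval_eq_add_nsmul (hg 1) 0
  refine ⟨p, fun t => ?_⟩
  have hp' : ∀ k : ℕ, g k = p.eval (k : ℂ) := fun k => by simpa using hp k
  have hrat : ∀ r : ℚ, g r = p.eval ((r : ℝ) : ℂ) := by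
    intro r
    set N := r.den
    have hN : (N : ℂ) ≠ 0 := by exact_mod_cast r.den_ne_zero
    have hN' : (N : ℝ) ≠ 0 := by exact_mod_cast r.den_ne_zero
    set M := r.num.natAbs
    obtain ⟨q, hq⟩ := exists_polynomial_eval_eq_add_nsmul (hg (1 / N)) (-M)
    -- `q` interpolates on the progression `-M + k / N`; rescaled, it agrees with `p` on `ℕ`.
    have hqp : q.comp (Polynomial.C (N : ℂ) * (Polynomial.X + Polynomial.C (M : ℂ))) = p := by
      refine Polynomial.eq_of_infinite_eval_eq _ _ ?_
      refine (Set.infinite_range_of_injective (Nat.cast_injective (R := ℂ))).mono ?_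
      rintro _ ⟨k, rfl⟩
      have h1 := hq (N * (k + M))
      have e : -(M : ℝ) + (N * (k + M)) • (1 / (N : ℝ)) = k := by
        rw [nsmul_eq_mul]; push_cast; field_simp; ring
      rw [e, hp'] at h1
      simp only [Set.mem_ofPred_eq, Polynomial.eval_comp, Polynomial.eval_mul, Polynomial.eval_C,
        Polynomial.eval_add, Polynomial.eval_X]
      rw [h1]
      push_cast
      rfl
    obtain ⟨k, hk⟩ : ∃ k : ℕ, (k : ℤ) = r.num + M * N := by
      refine ⟨(r.num + M * N).toNat, Int.toNat_of_nonneg ?_⟩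
      have h1 : -(M : ℤ) ≤ r.num := by simp only [M]; omega
      have h2 : (1 : ℤ) ≤ N := by exact_mod_cast r.den_pos
      nlinarith [Int.natCast_nonneg M]
    have hr : (r : ℝ) * N = r.num := by exact_mod_cast Rat.mul_den_eq_num r
    have hkR : (k : ℝ) = r.num + M * N := by exact_mod_cast hk
    have h1 := hq k
    have e : -(M : ℝ) + k • (1 / (N : ℝ)) = r := by
      rw [nsmul_eq_mul, hkR, ← hr]; field_simp; ring
    rw [e] at h1
    rw [h1, ← hqp]
    simp only [Polynomial.eval_comp, Polynomial.eval_mul, Polynomial.eval_C,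
        Polynomial.eval_add, Polynomial.eval_X]
    congr 1
    rw [← Complex.ofReal_natCast k, hkR, ← hr]
    push_cast
    ring
  have hcont : Continuous fun t : ℝ => p.eval (t : ℂ) :=
    p.continuous.comp Complex.continuous_ofReal
  exact congrFun (Rat.denseRange_cast.equalizer hgc hcont (funext hrat)) t

/-! ### The test space -/

theorem convergesTo_smul {d : ℕ} (φ : TestSpace d) {s : ℕ → ℝ} {t : ℝ}
    (hs : Tendsto s atTop (𝓝 t)) : ConvergesTo (fun k => s k • φ) (t • φ) := by
  have e : ∀ k, s k • φ - t • φ = (s k - t) • φ := fun k => (sub_smul _ _ _).symm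
  unfold ConvergesTo
  simp_rw [e]
  refine ⟨?_, fun q => ?_⟩
  · obtain ⟨r, hr⟩ := φ.hasCompactSupport.isCompact.isBounded.subset_ball 0
    refine ⟨r, fun k x hx => ?_⟩
    have : φ x = 0 := by
      by_contra h
      have := hr (subset_tsupport _ (Function.mem_support.2 h))
      rw [mem_ball_zero_iff] at this
      linarith
    simp [this]
  · have hcd : ContDiff ℝ q φ := φ.contDiff.of_le (by exact_mod_cast le_top)
    obtain ⟨C, hC⟩ := (φ.hasCompactSupport.iteratedFDeriv q).exists_bound_of_continuous
      hcd.continuous_iteratedFDeriv'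
    rw [Metric.tendstoUniformly_iff]
    intro ε hε
    have h1 : Tendsto (fun k => |s k - t| * C) atTop (𝓝 0) := by
      have := ((hs.sub_const t).abs).mul_const C
      simpa using this
    filter_upwards [h1.eventually_lt_const hε] with k hk x
    have e2 : iteratedFDeriv ℝ q ((s k - t) • φ : TestSpace d) x
        = (s k - t) • iteratedFDeriv ℝ q φ x :=
      iteratedFDeriv_const_smul_apply hcd.contDiffAt
    rw [dist_zero_left, e2, norm_smul, Real.norm_eq_abs]
    exact (mul_le_mul_of_nonneg_left (hC x) (abs_nonneg _)).trans_lt hk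

theorem continuous_comp_smul {d : ℕ} {P : TestSpace d → ℂ} (hP : IsContinuousFunctional P)
    (φ : TestSpace d) : Continuous fun t : ℝ => P (t • φ) :=
  continuous_iff_seqContinuous.2 fun _ _ hs => hP _ _ (convergesTo_smul φ hs)

theorem fwdDiff_iter_comp_smul {d : ℕ} (P : TestSpace d → ℂ) (φ : TestSpace d) (h : ℝ) (n : ℕ)
    (t : ℝ) :
    (fwdDiff h)^[n] (fun t : ℝ => P (t • φ)) t = (fwdDiff (h • φ))^[n] P (t • φ) := by
  simp only [fwdDiff_iter_eq_sum_shift, add_smul, smul_assoc]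

theorem charFun_map_eq_characteristicFunctional_smul {d : ℕ} {Ω : Type*} [MeasurableSpace Ω]
    {μ : Measure Ω} {Φ : TestSpace d → Ω → ℝ} (hΦ : IsGeneralizedRandomField μ Φ)
    (φ : TestSpace d) (t : ℝ) :
    charFun (μ.map (Φ φ)) t = characteristicFunctional μ Φ (t • φ) := by
  rw [charFun_apply_real, integral_map (hΦ.measurable φ).aemeasurable (by fun_prop),
    characteristicFunctional]
  refine integral_congr_ae ?_
  filter_upwards [hΦ.linear φ 0 t 0] with ω hω
  simp only [smul_zero, add_zero, zero_mul] at hω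
  rw [hω]
  push_cast
  ring_nf

/-- Convergence in the Fréchet space of test functions supported in a fixed compact set implies
convergence of test functions. -/
theorem convergesTo_ofSupportedIn {d : ℕ}
    {K : TopologicalSpace.Compacts (EuclideanSpace ℝ (Fin d))}
    (hK : (K : Set (EuclideanSpace ℝ (Fin d))) ⊆
      ((⊤ : TopologicalSpace.Opens (EuclideanSpace ℝ (Fin d))) : Set _))
    {u : ℕ → 𝓓_{K}(EuclideanSpace ℝ (Fin d), ℝ)} {φ : 𝓓_{K}(EuclideanSpace ℝ (Fin d), ℝ)}
    (hu : Tendsto u atTop (𝓝 φ)) :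
    ConvergesTo (fun k => TestFunction.ofSupportedIn hK (u k))
      (TestFunction.ofSupportedIn hK φ) := by
  refine ⟨?_, fun q => ?_⟩
  · obtain ⟨r, hr⟩ := K.isCompact.isBounded.subset_ball 0
    refine ⟨r, fun k x hx => ?_⟩
    have hxK : x ∉ (K : Set _) := fun h => by
      have := hr h
      rw [mem_ball_zero_iff] at this
      linarith
    change (u k - φ) x = 0
    exact (u k - φ).zero_on_compl hxK
  · have h := ((ContDiffMapSupportedIn.withSeminorms ℝ (EuclideanSpace ℝ (Fin d)) ℝ ⊤
      K).tendsto_nhds u φ).1 hu q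
    rw [Metric.tendstoUniformly_iff]
    intro ε hε
    filter_upwards [h ε hε] with k hk x
    rw [dist_zero_left]
    change ‖iteratedFDeriv ℝ q (u k - φ : 𝓓_{K}(EuclideanSpace ℝ (Fin d), ℝ)) x‖ < ε
    exact (ContDiffMapSupportedIn.norm_iteratedFDeriv_apply_le_seminorm_top ℝ).trans_lt hk

/-- A sequentially continuous linear functional is continuous for the inductive limit topology,
because the spaces of test functions supported in a fixed compact set are first countable. -/
theorem exists_distribution_of_sequentially_continuous {d : ℕ} (m : TestSpace d → ℝ)
    (hadd : ∀ φ ψ, m (φ + ψ) = m φ + m ψ) (hsmul : ∀ (c : ℝ) φ, m (c • φ) = c * m φ)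
    (hcont : ∀ (u : ℕ → TestSpace d) (φ : TestSpace d), ConvergesTo u φ →
      Tendsto (fun k => m (u k)) atTop (𝓝 (m φ))) :
    ∃ T : 𝓓'((⊤ : TopologicalSpace.Opens (EuclideanSpace ℝ (Fin d))), ℝ), ∀ φ, T φ = m φ := by
  refine ⟨TestFunction.mkCLM ℝ m hadd hsmul fun K hK => ?_, fun φ => rfl⟩
  have : FirstCountableTopology 𝓓_{K}(EuclideanSpace ℝ (Fin d), ℝ) :=
    (ContDiffMapSupportedIn.withSeminorms ℝ (EuclideanSpace ℝ (Fin d)) ℝ ⊤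
      K).firstCountableTopology
  exact continuous_iff_seqContinuous.2 fun u φ hu => hcont _ _ (convergesTo_ofSupportedIn hK hu)

/-! ### Gaussian generalized random fields -/

/-- The exponent `P` is a polynomial on the line through `φ`, so every value `Φ φ` is Gaussian; its
mean and variance determine `P φ` up to the additive constant `P 0`. -/
theorem exists_map_eq_gaussianReal {d : ℕ} {Ω : Type*} [MeasurableSpace Ω] {μ : Measure Ω}
    [IsProbabilityMeasure μ] {Φ : TestSpace d → Ω → ℝ} (hΦ : IsGeneralizedRandomField μ Φ)
    {P : TestSpace d → ℂ} (hP : IsPolynomialFunctional P) (hPc : IsContinuousFunctional P)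
    (hf : ∀ y, characteristicFunctional μ Φ y = Complex.exp (P y)) (φ : TestSpace d) :
    ∃ (m : ℝ) (v : NNReal), μ.map (Φ φ) = gaussianReal m v ∧
      P φ = P 0 + m * Complex.I - v / 2 := by
  obtain ⟨n, hn⟩ := hP
  obtain ⟨p, hp⟩ := exists_polynomial_eq_of_fwdDiff_iter_eq_zero (continuous_comp_smul hPc φ)
    (n := n) fun h y => by rw [fwdDiff_iter_comp_smul]; exact hn _ _
  have : IsProbabilityMeasure (μ.map (Φ φ)) :=
    Measure.isProbabilityMeasure_map (hΦ.measurable φ).aemeasurable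
  obtain ⟨m, v, hmv, hpe⟩ := exists_eq_gaussianReal_of_charFun_eq_exp (μ := μ.map (Φ φ)) (p := p)
    fun t => by rw [charFun_map_eq_characteristicFunctional_smul hΦ, hf, hp]
  refine ⟨m, v, hmv, ?_⟩
  have h0 := hp 0
  have h1 := hp 1
  rw [hpe 1] at h1
  rw [one_smul] at h1
  rw [zero_smul, Complex.ofReal_zero] at h0
  rw [h1, h0]
  push_cast
  ring

/-- A constant plus `i` times the mean minus half the variance is a quadratic functional: on each
line `k ↦ φ + k h` the mean is affine and the variance is quadratic. -/
theorem isPolynomialOfDegreeLE_two {d : ℕ} {Ω : Type*} [MeasurableSpace Ω] {μ : Measure Ω}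
    [IsProbabilityMeasure μ] {Φ : TestSpace d → Ω → ℝ} (hΦ : IsGeneralizedRandomField μ Φ)
    (hL : ∀ φ, MemLp (Φ φ) 2 μ) {P : TestSpace d → ℂ} {c : ℂ}
    (hP : ∀ φ, P φ = c + (∫ ω, Φ φ ω ∂μ : ℝ) * Complex.I - (Var[Φ φ; μ] : ℂ) / 2) :
    IsPolynomialOfDegreeLE P 2 := by
  intro φ h
  have hlin : ∀ k : ℝ, Φ (φ + k • h) =ᵐ[μ] Φ φ + k • Φ h := by
    intro k
    filter_upwards [hΦ.linear φ h 1 k] with ω hω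
    simpa using hω
  have hmean : ∀ k : ℝ, ∫ ω, Φ (φ + k • h) ω ∂μ = ∫ ω, Φ φ ω ∂μ + k * ∫ ω, Φ h ω ∂μ := by
    intro k
    rw [integral_congr_ae (hlin k), integral_add' ((hL φ).integrable one_le_two)
      (((hL h).integrable one_le_two).smul k)]
    simp [integral_const_mul]
  have hvar : ∀ k : ℝ, Var[Φ (φ + k • h); μ]
      = Var[Φ φ; μ] + 2 * k * cov[Φ φ, Φ h; μ] + k ^ 2 * Var[Φ h; μ] := by
    intro k
    rw [variance_congr (hlin k), variance_add (hL φ) ((hL h).const_smul k), variance_smul,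
      covariance_smul_right]
    ring
  have hPk : ∀ k : ℕ, P (φ + k • h) = c
      + ((∫ ω, Φ φ ω ∂μ + k * ∫ ω, Φ h ω ∂μ : ℝ) : ℂ) * Complex.I
      - ((Var[Φ φ; μ] + 2 * k * cov[Φ φ, Φ h; μ] + k ^ 2 * Var[Φ h; μ] : ℝ) : ℂ) / 2 := by
    intro k
    rw [← Nat.cast_smul_eq_nsmul ℝ k h, hP, hmean, hvar]
  rw [fwdDiff_iter_eq_sum_shift]
  simp only [hPk, Finset.sum_range_succ, Finset.sum_range_zero, zsmul_eq_mul]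
  simp [Nat.choose]
  ring

theorem theorem2p1 {d : ℕ} {Ω : Type*} [MeasurableSpace Ω] (μ : Measure Ω)
    [IsProbabilityMeasure μ] (Φ : TestSpace d → Ω → ℝ) (hΦ : IsGeneralizedRandomField μ Φ)
    (P : TestSpace d → ℂ) (hP : IsPolynomialFunctional P) (hPc : IsContinuousFunctional P)
    (hf : ∀ y, characteristicFunctional μ Φ y = Complex.exp (P y)) :
    polynomialDegree P ≤ 2 ∧ IsGaussianField μ Φ := by
  choose m v hlaw hPmv using exists_map_eq_gaussianReal hΦ hP hPc hf
  have hmeas : ∀ φ, AEMeasurable (Φ φ) μ := fun φ => (hΦ.measurable φ).aemeasurable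
  have hL : ∀ φ, MemLp (Φ φ) 2 μ := fun φ => by
    have h : MemLp id 2 (μ.map (Φ φ)) := by rw [hlaw]; exact memLp_id_gaussianReal 2
    exact (memLp_map_measure_iff aestronglyMeasurable_id (hmeas φ)).1 h
  have hm : ∀ φ, ∫ ω, Φ φ ω ∂μ = m φ := fun φ => by
    have h := integral_map (hmeas φ) (f := fun x : ℝ => x) aestronglyMeasurable_id
    rw [hlaw, integral_id_gaussianReal] at h
    exact h.symm
  have hv : ∀ φ, Var[Φ φ; μ] = v φ := fun φ => by
    rw [← variance_id_map (hmeas φ), hlaw, variance_id_gaussianReal]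
  have hlin : ∀ (φ ψ : TestSpace d) (α β : ℝ), m (α • φ + β • ψ) = α * m φ + β * m ψ := by
    intro φ ψ α β
    rw [← hm, ← hm, ← hm, integral_congr_ae (hΦ.linear φ ψ α β),
      integral_add (((hL φ).integrable one_le_two).const_mul α)
        (((hL ψ).integrable one_le_two).const_mul β), integral_const_mul, integral_const_mul]
  -- The mean inherits sequential continuity from the imaginary part of `P`.
  have him : ∀ φ, m φ = (P φ).im - (P 0).im := fun φ => by
    rw [hPmv φ]
    simp
  obtain ⟨T, hT⟩ := exists_distribution_of_sequentially_continuous m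
    (fun φ ψ => by simpa using hlin φ ψ 1 1) (fun c φ => by simpa using hlin φ 0 c 0)
    (fun u φ hu => by
      simp only [him]
      exact ((Complex.continuous_im.tendsto _).comp (hPc u φ hu)).sub_const _)
  refine ⟨Nat.sInf_le (isPolynomialOfDegreeLE_two hΦ hL (c := P 0) fun φ => ?_), hΦ, hL, T,
    fun φ => by rw [hm, hT], fun φ => ?_⟩
  · rw [hm, hv]
    exact hPmv φ
  · have h := charFun_map_eq_characteristicFunctional_smul hΦ φ 1
    rw [one_smul, hlaw, charFun_gaussianReal] at h
    rw [← h, covariance_self (hmeas φ), hv, hT]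
    congr 1
    push_cast
    ring
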